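/- Let $(M,g)$ be a smooth $(N+1)$-dimensional Lorentzian manifold of signature $(+,-,\dots,-)$ with a spin structure, let $\gamma^a$ (with $\gamma^a\gamma^b+\gamma^b\gamma^a=2\eta^{ab}$) be gamma matrices on $\mathbb C^k$, $k\ge1$, and let $DM$ be the associated spinor bundle with spin connection $\nabla_\mu=\partial_\mu+S_\mu$, $S_\mu=\frac18[\gamma^a,\gamma^b]\,e_a^\nu\nabla_\mu e_{b\nu}$ in a spin frame with underlying orthonormal frame $(e_a)$. Let $m\in\mathbb R$ and $$P=\square+\tfrac14R+m^2,\qquad \square=g^{\mu\nu}\nabla_\mu\nabla_\nu ,$$ where $R$ is the scalar curvature (with the sign for which $P=(i\gamma^\mu\nabla_\mu-m)(-i\gamma^\mu\nabla_\mu-m)$). In local coordinates and a spin frame write the full symbol as $\sigma(P)(x,\xi)=e^{-ix\xi}Pe^{ix\xi}=p_0+p_1+p_2$ with $p_j$ homogeneous of degree $2-j$ in $\xi$. Given a matrix symbol $\tilde p_0$ and a scalar symbol $q$ with $\tilde p_0p_0=q\,1_k$ and $\partial_\xi q\ne0$ for $\xi\neq0$, the Dencker connection of $P$ acts on smooth $\mathbb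 C^k$-valued functions $f$ on $\mathcal Q_P=\{\det p_0=0\}\subset T^*M$ by $$D_Pf=X_qf+\tfrac12\{\tilde p_0,p_0\}f+i\,\tilde p_0\,p^sf,\qquad p^s=p_1+\tfrac i2\sum_\mu\frac{\partial^2p_0}{\partial\xi_\mu\partial x^\mu},$$ with $X_q=\partial_\xi q\,\partial_x-\partial_xq\,\partial_\xi$ and $\{A,B\}=\partial_\xi A\,\partial_xB-\partial_xA\,\partial_\xi B$. **Proposition.** In all coordinate charts and spin frames the following holds. The principal symbol of $P$ is $p_0(x,\xi)=-g^{\mu\nu}(x)\xi_\mu\xi_\nu\,1_k$; hence $P$ is of real principal type with $\tilde p_0=1_k$ and $q=-g^{\mu\nu}\xi_\mu\xi_\nu$ (again denoted $p_0$), and $\mathcal Q_P=\{g^{\mu\nu}(x)\xi_\mu\xi_\nu=0\}$. With this choice, $D_P$ is a well-defined partial connection along $X_{p_0}$ over $\mathcal Q_P$: on $\mathcal Q_P$ the value $D_Pf$ depends only on $f|_{\mathcal Q_P}$, and $D_P(hf)=(X_{p_0}h)f+h\,D_Pf$ for smooth complex functions $h$. Moreover, on $\mathcal Q_P$, $$D_P=\mathrm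 i_{X_{p_0}}\circ\pi^*\bigl(\nabla+\tfrac14\,d\log|g|\bigr).$$ Here $\pi:T^*M\to M$ is the projection, $\mathrm i_{X_{p_0}}$ is insertion of the Hamiltonian vector field, $|g|=|\det(g_{\mu\nu})|$, and $\frac14d\log|g|$ is the connection form contributed by the half-density factor in the coordinates used; i.e. $D_Pf=X_{p_0}f+d\pi(X_{p_0})^\mu\bigl(S_\mu+\frac14\partial_\mu\log|g|\bigr)f$. (The $\mathbb C^k$-valued functions are the components in the chosen spin frame and coordinates.) -/

import Mathlib

open scoped Manifold ContDiff Matrix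

namespace SpinorKG

noncomputable section

/-! ### Minkowski space, spacetimes and spin structures -/

/-- The coordinate space `ℝ^{N+1}` of an `(N+1)`-dimensional spacetime. -/
abbrev Coord (N : ℕ) : Type := EuclideanSpace ℝ (Fin (N + 1))

/-- The coordinate cotangent space: pairs `(x, ξ)` of a point and a covector. -/
abbrev Phase (N : ℕ) : Type := Coord N × Coord N

/-- The `μ`-th standard basis vector. -/
abbrev basisVec {N : ℕ} (μ : Fin (N + 1)) : Coord N := EuclideanSpace.single μ (1 : ℝ)

/-- The signs `(+1, -1, …, -1)` of the Minkowski metric. -/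
def etaSign (N : ℕ) (a : Fin (N + 1)) : ℝ := if a = 0 then 1 else -1

/-- The Minkowski quadratic form `v ↦ (v⁰)² - (v¹)² - … - (v^N)²`. -/
def minkowskiForm (N : ℕ) : QuadraticForm ℝ (Fin (N + 1) → ℝ) :=
  QuadraticMap.weightedSumSquares ℝ (etaSign N)

/-- A smooth Lorentzian metric of signature `(+, -, …, -)` on `M`. -/
structure LorentzMetric (N : ℕ) (M : Type*) [TopologicalSpace M] [ChartedSpace (Coord N) M] where
  val : ∀ p : M, TangentSpace (𝓡 (N + 1)) p →ₗ[ℝ] TangentSpace (𝓡 (N + 1)) p →ₗ[ℝ] ℝ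
  symm : ∀ p v w, val p v w = val p w v
  signature : ∀ p, ∃ b : Module.Basis (Fin (N + 1)) ℝ (TangentSpace (𝓡 (N + 1)) p),
    ∀ a c, val p (b a) (b c) = if a = c then etaSign N a else 0
  smooth : ∀ φ ∈ IsManifold.maximalAtlas (𝓡 (N + 1)) ∞ M, ∀ μ ν : Fin (N + 1),
    ContDiffOn ℝ ∞ (fun x : Coord N => val (φ.symm x)
      (mfderiv (𝓡 (N + 1)) (𝓡 (N + 1)) φ.symm x (basisVec μ))
      (mfderiv (𝓡 (N + 1)) (𝓡 (N + 1)) φ.symm x (basisVec ν))) φ.target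

section Spacetime

variable {N : ℕ} {M : Type*} [TopologicalSpace M] [ChartedSpace (Coord N) M]

/-- The components `g_{μν}` of a metric in the coordinates of a chart. -/
def LorentzMetric.coordMatrix (g : LorentzMetric N M) (φ : OpenPartialHomeomorph M (Coord N))
    (x : Coord N) : Matrix (Fin (N + 1)) (Fin (N + 1)) ℝ :=
  Matrix.of fun μ ν => g.val (φ.symm x)
    (mfderiv (𝓡 (N + 1)) (𝓡 (N + 1)) φ.symm x (basisVec μ))
    (mfderiv (𝓡 (N + 1)) (𝓡 (N + 1)) φ.symm x (basisVec ν))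

/-- The components `v^μ` of a vector field on `M` in the coordinates of a chart. -/
def coordVec (v : ∀ p : M, TangentSpace (𝓡 (N + 1)) p) (φ : OpenPartialHomeomorph M (Coord N))
    (μ : Fin (N + 1)) (x : Coord N) : ℝ :=
  (show Coord N from mfderiv (𝓡 (N + 1)) (𝓡 (N + 1)) φ (φ.symm x) (v (φ.symm x))) μ

/-- A spin structure on the (oriented and time-oriented) Lorentzian manifold `(M, g)`, as a
cocycle: local smooth orthonormal frames `frame i` on open sets `dom i` that cover `M`, and smooth
lifts `trans i j` of their transition functions to the spin group, which form a cocycle. An element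
`i : ι` is called a *spin frame*. For a representation `ρ` of the Clifford algebra on `ℂ^k`
the associated spinor bundle `DM` is glued from the products `dom i × ℂ^k` by means of
`ψ_i = ρ (trans i j) ψ_j`. -/
structure SpinStructure (g : LorentzMetric N M) (ι : Type*) where
  dom : ι → Set M
  isOpen_dom : ∀ i, IsOpen (dom i)
  cover : ∀ p, ∃ i, p ∈ dom i
  frame : ι → Fin (N + 1) → ∀ p : M, TangentSpace (𝓡 (N + 1)) p
  orthonormal : ∀ i, ∀ p ∈ dom i, ∀ a b,
    g.val p (frame i a p) (frame i b p) = if a = b then etaSign N a else 0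
  smooth_frame : ∀ i, ∀ φ ∈ IsManifold.maximalAtlas (𝓡 (N + 1)) ∞ M, ∀ a μ,
    ContDiffOn ℝ ∞ (coordVec (frame i a) φ μ) (φ.target ∩ φ.symm ⁻¹' dom i)
  trans : ι → ι → M → CliffordAlgebra (minkowskiForm N)
  trans_mem : ∀ i j, ∀ p ∈ dom i ∩ dom j, trans i j p ∈ spinGroup (minkowskiForm N)
  smooth_trans : ∀ i j, ∀ φ ∈ IsManifold.maximalAtlas (𝓡 (N + 1)) ∞ M,
    ∀ l : CliffordAlgebra (minkowskiForm N) →ₗ[ℝ] ℝ,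
      ContDiffOn ℝ ∞ (fun x => l (trans i j (φ.symm x)))
        (φ.target ∩ φ.symm ⁻¹' (dom i ∩ dom j))
  cocycle : ∀ i j l, ∀ p ∈ dom i ∩ dom j ∩ dom l, trans i j p * trans j l p = trans i l p
  lifts : ∀ i j, ∀ p ∈ dom i ∩ dom j, ∀ v w : Fin (N + 1) → ℝ,
    ∑ b, v b • frame j b p = ∑ a, w a • frame i a p →
      trans i j p * CliffordAlgebra.ι (minkowskiForm N) v =
        CliffordAlgebra.ι (minkowskiForm N) w * trans i j p

/-- The coordinate domain on which both the coordinates `φ` and the spin frame `i` live. -/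
def SpinStructure.coordDom {g : LorentzMetric N M} {ι : Type*} (𝔰 : SpinStructure g ι) (i : ι)
    (φ : OpenPartialHomeomorph M (Coord N)) : Set (Coord N) :=
  φ.target ∩ φ.symm ⁻¹' 𝔰.dom i

/-- The coordinate components `e_a^μ` of a spin frame. -/
def SpinStructure.coordFrame {g : LorentzMetric N M} {ι : Type*} (𝔰 : SpinStructure g ι) (i : ι)
    (φ : OpenPartialHomeomorph M (Coord N)) (a μ : Fin (N + 1)) : Coord N → ℝ :=
  coordVec (𝔰.frame i a) φ μ

end Spacetime

/-! ### The Levi-Civita and spin connections and the Klein-Gordon operator in local coordinates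

Here `G` stands for the components `g_{μν}` of the metric and `e` for the components `e_a^μ` of an
orthonormal frame. -/

section Local

variable {N k : ℕ}

/-- The partial derivative `∂_μ F` on coordinate space. -/
def pd {V : Type*} [NormedAddCommGroup V] [NormedSpace ℝ V] (μ : Fin (N + 1)) (F : Coord N → V)
    (x : Coord N) : V :=
  fderiv ℝ F x (basisVec μ)

/-- The Christoffel symbols `Γ^l_{μν}`. -/
def christoffel (G : Coord N → Matrix (Fin (N + 1)) (Fin (N + 1)) ℝ) (l μ ν : Fin (N + 1))
    (x : Coord N) : ℝ :=
  (1 / 2) * ∑ σ, (G x)⁻¹ l σ *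
    (pd μ (fun y => G y ν σ) x + pd ν (fun y => G y μ σ) x - pd σ (fun y => G y μ ν) x)

/-- The scalar curvature `R`. The Riemann tensor is
`R^r_{σμν} = ∂_μ Γ^r_{νσ} - ∂_ν Γ^r_{μσ} + Γ^r_{μl} Γ^l_{νσ} - Γ^r_{νl} Γ^l_{μσ}` and the Ricci
tensor is its contraction `R^r_{σνr}`; for the signature `(+, -, …, -)` this is the sign for which
the Lichnerowicz identity `(i∂̸ - m)(-i∂̸ - m) = □ + R/4 + m²` holds. -/
def scalarCurvature (G : Coord N → Matrix (Fin (N + 1)) (Fin (N + 1)) ℝ) (x : Coord N) : ℝ :=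
  ∑ σ, ∑ ν, (G x)⁻¹ σ ν * ∑ r,
    (pd ν (christoffel G r r σ) x - pd r (christoffel G r ν σ) x
      + ∑ l, (christoffel G r ν l x * christoffel G l r σ x
        - christoffel G r r l x * christoffel G l ν σ x))

/-- The covariant derivative `∇_μ e_b^ν` of the `b`-th frame vector. -/
def covFrame (G : Coord N → Matrix (Fin (N + 1)) (Fin (N + 1)) ℝ)
    (e : Fin (N + 1) → Fin (N + 1) → Coord N → ℝ) (μ b ν : Fin (N + 1)) (x : Coord N) : ℝ :=
  pd μ (e b ν) x + ∑ l, christoffel G ν μ l x * e b l x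

/-- The gamma matrices `γ^a` (with upper index): `γ^a γ^b + γ^b γ^a = 2 η^{ab}`. -/
def gamma (ρ : CliffordAlgebra (minkowskiForm N) →ₐ[ℝ] Matrix (Fin k) (Fin k) ℂ)
    (a : Fin (N + 1)) : Matrix (Fin k) (Fin k) ℂ :=
  etaSign N a • ρ (CliffordAlgebra.ι (minkowskiForm N) (Pi.single a 1))

/-- The spin connection `S_μ = (1/8) [γ^a, γ^b] e_a^ν ∇_μ e_{bν}`. -/
def spinForm (G : Coord N → Matrix (Fin (N + 1)) (Fin (N + 1)) ℝ)
    (e : Fin (N + 1) → Fin (N + 1) → Coord N → ℝ)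
    (ρ : CliffordAlgebra (minkowskiForm N) →ₐ[ℝ] Matrix (Fin k) (Fin k) ℂ)
    (μ : Fin (N + 1)) (x : Coord N) : Matrix (Fin k) (Fin k) ℂ :=
  ∑ a, ∑ b, ((1 / 8) * ∑ ν, ∑ l, e a ν x * G x ν l * covFrame G e μ b l x) •
    (gamma ρ a * gamma ρ b - gamma ρ b * gamma ρ a)

/-- The covariant derivative `∇_μ ψ = ∂_μ ψ + S_μ ψ` of a spinor field. -/
def covSpinor (G : Coord N → Matrix (Fin (N + 1)) (Fin (N + 1)) ℝ)
    (e : Fin (N + 1) → Fin (N + 1) → Coord N → ℝ)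
    (ρ : CliffordAlgebra (minkowskiForm N) →ₐ[ℝ] Matrix (Fin k) (Fin k) ℂ)
    (μ : Fin (N + 1)) (ψ : Coord N → Fin k → ℂ) (x : Coord N) : Fin k → ℂ :=
  pd μ ψ x + spinForm G e ρ μ x *ᵥ ψ x

/-- The spinorial Klein-Gordon operator `P = □ + R/4 + m²`, where `□ = g^{μν} ∇_μ ∇_ν` and
`∇_μ ∇_ν ψ = ∂_μ (∇_ν ψ) + S_μ ∇_ν ψ - Γ^l_{μν} ∇_l ψ`. -/
def kleinGordon (G : Coord N → Matrix (Fin (N + 1)) (Fin (N + 1)) ℝ)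
    (e : Fin (N + 1) → Fin (N + 1) → Coord N → ℝ)
    (ρ : CliffordAlgebra (minkowskiForm N) →ₐ[ℝ] Matrix (Fin k) (Fin k) ℂ) (m : ℝ)
    (ψ : Coord N → Fin k → ℂ) (x : Coord N) : Fin k → ℂ :=
  ∑ μ, ∑ ν, (G x)⁻¹ μ ν •
      (covSpinor G e ρ μ (covSpinor G e ρ ν ψ) x
        - ∑ l, christoffel G l μ ν x • covSpinor G e ρ l ψ x)
    + ((1 / 4) * scalarCurvature G x + m ^ 2) • ψ x

/-! ### Symbols and the Dencker connection -/

/-- The full symbol `σ(P)(x, ξ) = e^{-ixξ} P e^{ixξ}` of a differential operator. -/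
def fullSymbol (P : (Coord N → Fin k → ℂ) → Coord N → Fin k → ℂ) (z : Phase N) :
    Matrix (Fin k) (Fin k) ℂ :=
  Matrix.of fun a b => Complex.exp (-Complex.I * ((∑ μ, z.1 μ * z.2 μ : ℝ) : ℂ)) *
    P (fun y => Complex.exp (Complex.I * ((∑ μ, y μ * z.2 μ : ℝ) : ℂ)) •
      (Pi.single b 1 : Fin k → ℂ)) z.1 a

/-- The term `p_j`, homogeneous of degree `r - j` in `ξ`, of a symbol `σ` of order `r` that is
polynomial in `ξ`: the coefficient of `t^{r - j}` in `σ(x, tξ)`. -/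
def symbolTerm (r : ℕ) (σ : Phase N → Matrix (Fin k) (Fin k) ℂ) (j : ℕ) (z : Phase N) :
    Matrix (Fin k) (Fin k) ℂ :=
  Matrix.of fun a b => (((r - j).factorial : ℂ))⁻¹ *
    iteratedDeriv (r - j) (fun t : ℝ => σ (z.1, t • z.2) a b) 0

/-- The partial derivative `∂/∂x^μ` on phase space. -/
def dX {V : Type*} [NormedAddCommGroup V] [NormedSpace ℝ V] (μ : Fin (N + 1)) (F : Phase N → V)
    (z : Phase N) : V :=
  fderiv ℝ F z (basisVec μ, 0)

/-- The partial derivative `∂/∂ξ_μ` on phase space. -/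
def dXi {V : Type*} [NormedAddCommGroup V] [NormedSpace ℝ V] (μ : Fin (N + 1)) (F : Phase N → V)
    (z : Phase N) : V :=
  fderiv ℝ F z (0, basisVec μ)

/-- `∂/∂x^μ` of a matrix-valued function, entry by entry. -/
def matDX (μ : Fin (N + 1)) (F : Phase N → Matrix (Fin k) (Fin k) ℂ) (z : Phase N) :
    Matrix (Fin k) (Fin k) ℂ :=
  Matrix.of fun a b => dX μ (fun w => F w a b) z

/-- `∂/∂ξ_μ` of a matrix-valued function, entry by entry. -/
def matDXi (μ : Fin (N + 1)) (F : Phase N → Matrix (Fin k) (Fin k) ℂ) (z : Phase N) :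
    Matrix (Fin k) (Fin k) ℂ :=
  Matrix.of fun a b => dXi μ (fun w => F w a b) z

/-- The Hamiltonian vector field `X_q = ∂_ξ q ∂_x - ∂_x q ∂_ξ`. -/
def hamVec (q : Phase N → ℝ) (z : Phase N) : Phase N :=
  (WithLp.toLp 2 fun μ => dXi μ q z, WithLp.toLp 2 fun μ => -dX μ q z)

/-- The bracket `{A, B} = ∂_ξ A ∂_x B - ∂_x A ∂_ξ B` of matrix symbols. -/
def matBracket (A B : Phase N → Matrix (Fin k) (Fin k) ℂ) (z : Phase N) :
    Matrix (Fin k) (Fin k) ℂ :=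
  ∑ μ, (matDXi μ A z * matDX μ B z - matDX μ A z * matDXi μ B z)

/-- The subprincipal symbol `p^s = p_1 + (i/2) ∑_μ ∂²p_0/∂ξ_μ∂x^μ`. -/
def subprincipal (p₀ p₁ : Phase N → Matrix (Fin k) (Fin k) ℂ) (z : Phase N) :
    Matrix (Fin k) (Fin k) ℂ :=
  p₁ z + (Complex.I / 2) • ∑ μ, matDXi μ (matDX μ p₀) z

/-- The matrix symbol `pt` (usually written `p̃_0`) and the scalar symbol `q` exhibit a system with
principal symbol `p₀` as being of real principal type over `Ω`. -/
structure IsRealPrincipalFactor (Ω : Set (Phase N)) (p₀ pt : Phase N → Matrix (Fin k) (Fin k) ℂ)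
    (q : Phase N → ℝ) : Prop where
  smooth_pt : ∀ a b, ContDiffOn ℝ ∞ (fun z => pt z a b) Ω
  smooth_q : ContDiffOn ℝ ∞ q Ω
  factor : ∀ z ∈ Ω, pt z * p₀ z = (q z : ℂ) • (1 : Matrix (Fin k) (Fin k) ℂ)
  nondegenerate : ∀ z ∈ Ω, z.2 ≠ 0 → ∃ μ, dXi μ q z ≠ 0

/-- The characteristic set `det p_0 = 0` over `Ω`. -/
def charSet (Ω : Set (Phase N)) (p₀ : Phase N → Matrix (Fin k) (Fin k) ℂ) : Set (Phase N) :=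
  {z ∈ Ω | (p₀ z).det = 0}

/-- The Dencker connection `D_P f = X_q f + (1/2) {p̃_0, p_0} f + i p̃_0 p^s f`, formed with
`p̃_0 = pt` and the scalar `q` from the terms `p₀, p₁` of the symbol of a system. -/
def dencker (p₀ p₁ pt : Phase N → Matrix (Fin k) (Fin k) ℂ) (q : Phase N → ℝ)
    (f : Phase N → Fin k → ℂ) (z : Phase N) : Fin k → ℂ :=
  fderiv ℝ f z (hamVec q z) + (1 / 2 : ℂ) • (matBracket pt p₀ z *ᵥ f z)
    + Complex.I • ((pt z * subprincipal p₀ p₁ z) *ᵥ f z)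

/-! ### The pulled back connection -/

/-- The connection form `(1/4) d log |g|` of the half-density factor. -/
def halfDensityForm (G : Coord N → Matrix (Fin (N + 1)) (Fin (N + 1)) ℝ) (μ : Fin (N + 1))
    (x : Coord N) : ℝ :=
  (1 / 4) * pd μ (fun y => Real.log |(G y).det|) x

/-- The connection form of `∇ + (1/4) d log |g|`: spin connection twisted by half-densities. -/
def twistedForm (G : Coord N → Matrix (Fin (N + 1)) (Fin (N + 1)) ℝ)
    (e : Fin (N + 1) → Fin (N + 1) → Coord N → ℝ)
    (ρ : CliffordAlgebra (minkowskiForm N) →ₐ[ℝ] Matrix (Fin k) (Fin k) ℂ)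
    (μ : Fin (N + 1)) (x : Coord N) : Matrix (Fin k) (Fin k) ℂ :=
  spinForm G e ρ μ x + halfDensityForm G μ x • (1 : Matrix (Fin k) (Fin k) ℂ)

/-- The covariant derivative along a vector field `Y` on phase space for the pull-back `π^*(d + A)`
under `π (x, ξ) = x` of the connection `d + A_μ dx^μ`: the connection form is inserted on
`dπ(Y) = Y.1`. -/
def pullbackCov (A : Fin (N + 1) → Coord N → Matrix (Fin k) (Fin k) ℂ) (Y : Phase N → Phase N)
    (f : Phase N → Fin k → ℂ) (z : Phase N) : Fin k → ℂ :=
  fderiv ℝ f z (Y z) + ∑ μ, (Y z).1 μ • (A μ z.1 *ᵥ f z)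

/-- The scalar metric symbol `-g^{μν}(x) ξ_μ ξ_ν`. -/
def metricSymbol (G : Coord N → Matrix (Fin (N + 1)) (Fin (N + 1)) ℝ) (z : Phase N) : ℝ :=
  -∑ μ, ∑ ν, (G z.1)⁻¹ μ ν * z.2 μ * z.2 ν

end Local

end

end SpinorKG

open SpinorKG

/-! Conjugation by the plane wave `e^{ixξ}` turns `∂_μ` into `∂_μ + iξ_μ`, so the symbol of `P` is a
quadratic polynomial in `ξ`. Its top part is `q = -g^{μν} ξ_μ ξ_ν` times the identity, and its
linear part is `p_1 = i g^{μν} (ξ_μ S_ν + ξ_ν S_μ - Γ^l_{μν} ξ_l)`. Curvature, mass, and the terms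
in `∂S`, `SS` and `ΓS` all have degree zero and never enter `D_P`.

Since `p̃_0 = 1`, the bracket vanishes and `D_P = X_q + i p^s`. The spin part of `i p^s` is `-2
g^{μν} ξ_ν S_μ = ∂q/∂ξ_μ S_μ`, which is `S` inserted on `dπ(X_q)`. The scalar part is `g^{μν}
Γ^l_{μν} ξ_l - (1/2) ∑ ∂²q/∂ξ_μ∂x^μ`. Jacobi's formula for `d log |g|` evaluates the contracted
Christoffel symbols (`contracted_christoffel`). The subprincipal correction cancels the divergence
`∂_μ g^{μl}`, and what remains is the half-density form on `dπ(X_q)`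
(`sum_dXi_mul_halfDensityForm`). `dencker_kleinGordon` combines the two parts; the identity holds
over the whole coordinate domain, not only on the characteristic set.

That `D_P f` depends only on `f` along `{q = 0}` is tangency of `X_q` to the level sets of `q`. A
Lagrange multiplier argument (`fderiv_hamVec_eq_zero`) proves it also at the zero section, where `dq
= 0`. The Leibniz rule is then that of a pulled back connection. -/

namespace SpinorKG

/-! ### Partial derivatives on coordinate space. -/

section Calculus

variable {N : ℕ}

theorem pd_mul {F F' : Coord N → ℝ} {x : Coord N} (μ : Fin (N + 1))
    (hF : DifferentiableAt ℝ F x) (hF' : DifferentiableAt ℝ F' x) :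
    pd μ (fun y => F y * F' y) x = pd μ F x * F' x + F x * pd μ F' x := by
  simp only [pd, fderiv_fun_mul hF hF', _root_.add_apply, _root_.smul_apply,
    smul_eq_mul]
  ring

theorem pd_sum {V : Type*} [NormedAddCommGroup V] [NormedSpace ℝ V] {α : Type*} {s : Finset α}
    {F : α → Coord N → V} {x : Coord N} (μ : Fin (N + 1))
    (hF : ∀ a ∈ s, DifferentiableAt ℝ (F a) x) :
    pd μ (fun y => ∑ a ∈ s, F a y) x = ∑ a ∈ s, pd μ (F a) x := by
  simp only [pd, fderiv_fun_sum hF, _root_.sum_apply]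

theorem pd_congr {V : Type*} [NormedAddCommGroup V] [NormedSpace ℝ V] {F F' : Coord N → V}
    {x : Coord N} (μ : Fin (N + 1)) (h : F =ᶠ[nhds x] F') : pd μ F x = pd μ F' x := by
  simp only [pd, h.fderiv_eq]

theorem contDiffOn_pd {V : Type*} [NormedAddCommGroup V] [NormedSpace ℝ V] {F : Coord N → V}
    {U : Set (Coord N)} (hU : IsOpen U) (μ : Fin (N + 1)) (hF : ContDiffOn ℝ ∞ F U) :
    ContDiffOn ℝ ∞ (pd μ F) U :=
  (hF.fderiv_of_isOpen hU le_rfl).clm_apply contDiffOn_const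

end Calculus

/-! ### Smoothness and derivatives of determinants and inverses. -/

section MatrixCalculus

variable {E : Type*} [NormedAddCommGroup E] [NormedSpace ℝ E] {n : Type*} [Fintype n]
  [DecidableEq n]

theorem contDiffOn_det {r : WithTop ℕ∞} {A : E → Matrix n n ℝ} {U : Set E}
    (hA : ∀ i j, ContDiffOn ℝ r (fun x => A x i j) U) : ContDiffOn ℝ r (fun x => (A x).det) U := by
  simp only [Matrix.det_apply']
  exact ContDiffOn.sum fun σ _ => contDiffOn_const.mul (contDiffOn_prod fun i _ => hA _ _)

/-- Cramer's rule: each entry of the inverse is a quotient of two determinants, hence of polynomials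
in the entries. -/
theorem contDiffOn_matrix_inv {r : WithTop ℕ∞} {A : E → Matrix n n ℝ} {U : Set E}
    (hA : ∀ i j, ContDiffOn ℝ r (fun x => A x i j) U) (hdet : ∀ x ∈ U, (A x).det ≠ 0) (i j : n) :
    ContDiffOn ℝ r (fun x => (A x)⁻¹ i j) U := by
  have h : ∀ x, (A x)⁻¹ i j = (A x).det⁻¹ * ((A x).updateRow j (Pi.single i 1)).det := fun x => by
    rw [Matrix.inv_def, Ring.inverse_eq_inv', Matrix.smul_apply, Matrix.adjugate_apply, smul_eq_mul]
  simp only [h]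
  refine ((contDiffOn_det hA).inv hdet).mul (contDiffOn_det fun a b => ?_)
  by_cases hab : a = j
  · subst hab
    simpa only [Matrix.updateRow_self] using contDiffOn_const
  · simpa only [Matrix.updateRow_ne hab] using hA a b

/-- Jacobi's formula. -/
theorem hasFDerivAt_det {A : E → Matrix n n ℝ} {A' : n → n → E →L[ℝ] ℝ} {x : E}
    (hA : ∀ i j, HasFDerivAt (fun y => A y i j) (A' i j) x) :
    HasFDerivAt (fun y => (A y).det) (∑ i, ∑ j, (A x).adjugate i j • A' j i) x := by
  have h : HasFDerivAt (fun y => ∑ σ : Equiv.Perm n, ((Equiv.Perm.sign σ : ℤ) : ℝ) *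
      ∏ i, A y (σ i) i)
      (∑ σ : Equiv.Perm n, ((Equiv.Perm.sign σ : ℤ) : ℝ) •
        ∑ i, (∏ j ∈ Finset.univ.erase i, A x (σ j) j) • A' (σ i) i) x :=
    HasFDerivAt.fun_sum fun σ _ =>
      (HasFDerivAt.finsetProd fun i _ => hA (σ i) i).const_mul _
  simp only [← Matrix.det_apply'] at h
  refine h.congr_fderiv ?_
  ext v
  simp only [_root_.sum_apply, _root_.smul_apply, smul_eq_mul]
  -- By Cramer, a row of the adjugate paired with the derivative of column `i` is the determinant
  -- with that column replaced. Both sides then become the same double sum over permutations and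
  -- columns.
  have hc : ∀ i, ∑ j, (A x).adjugate i j * A' j i v
      = ((A x).updateCol i fun j => A' j i v).det := fun i => by
    rw [← Matrix.cramer_apply, Matrix.cramer_eq_adjugate_mulVec]
    rfl
  simp only [hc, Matrix.det_apply', Finset.mul_sum]
  rw [Finset.sum_comm]
  refine Finset.sum_congr rfl fun i _ => Finset.sum_congr rfl fun σ _ => ?_
  rw [← Finset.mul_prod_erase Finset.univ _ (Finset.mem_univ i), Matrix.updateCol_self]
  congr 1
  rw [mul_comm]
  congr 1
  exact Finset.prod_congr rfl fun j hj => by rw [Matrix.updateCol_ne (Finset.ne_of_mem_erase hj)]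

end MatrixCalculus

/-! ### Christoffel symbols and the logarithmic derivative of the metric determinant. -/

section LeviCivita

variable {N : ℕ} {G : Coord N → Matrix (Fin (N + 1)) (Fin (N + 1)) ℝ} {U : Set (Coord N)}
  {x : Coord N}

/-- The entrywise partial derivative of a matrix-valued function. -/
noncomputable def pdMatrix (G : Coord N → Matrix (Fin (N + 1)) (Fin (N + 1)) ℝ) (μ : Fin (N + 1))
    (x : Coord N) : Matrix (Fin (N + 1)) (Fin (N + 1)) ℝ :=
  Matrix.of fun α β => pd μ (fun y => G y α β) x

/-- Jacobi's formula divided by the determinant, which turns the adjugate into the inverse.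
`Real.log` is even, so the absolute value plays no role. -/
theorem pd_log_abs_det (hG : ∀ α β, DifferentiableAt ℝ (fun y => G y α β) x)
    (hdet : (G x).det ≠ 0) (μ : Fin (N + 1)) :
    pd μ (fun y => Real.log |(G y).det|) x = ∑ α, ∑ β, (G x)⁻¹ α β * pdMatrix G μ x β α := by
  have h := (hasFDerivAt_det fun α β => (hG α β).hasFDerivAt).log hdet
  simp only [Real.log_abs, pd, h.fderiv, pdMatrix, Matrix.inv_def, Ring.inverse_eq_inv',
    _root_.sum_apply, _root_.smul_apply, smul_eq_mul,
    Matrix.smul_apply, Finset.mul_sum, Matrix.of_apply, mul_assoc]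

theorem differentiableAt_inv_apply (hU : IsOpen U) (hG : ∀ α β, ContDiffOn ℝ ∞ (fun y => G y α β) U)
    (hdet : ∀ y ∈ U, (G y).det ≠ 0) (hx : x ∈ U) (α β : Fin (N + 1)) :
    DifferentiableAt ℝ (fun y => (G y)⁻¹ α β) x :=
  ((contDiffOn_matrix_inv hG hdet α β).contDiffAt (hU.mem_nhds hx)).differentiableAt (by simp)

/-- Differentiate `G G⁻¹ = 1`, valid near `x`, and multiply by `G⁻¹` from the left. -/
theorem pdMatrix_inv (hU : IsOpen U) (hG : ∀ α β, ContDiffOn ℝ ∞ (fun y => G y α β) U)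
    (hdet : ∀ y ∈ U, (G y).det ≠ 0) (hx : x ∈ U) (μ : Fin (N + 1)) :
    pdMatrix (fun y => (G y)⁻¹) μ x = -((G x)⁻¹ * pdMatrix G μ x * (G x)⁻¹) := by
  have hGd : ∀ α β, DifferentiableAt ℝ (fun y => G y α β) x := fun α β =>
    ((hG α β).contDiffAt (hU.mem_nhds hx)).differentiableAt (by simp)
  have hHd := differentiableAt_inv_apply hU hG hdet hx
  have key : pdMatrix G μ x * (G x)⁻¹ + G x * pdMatrix (fun y => (G y)⁻¹) μ x = 0 := by
    ext α β
    have h1 : (fun y => ∑ l, G y α l * (G y)⁻¹ l β) =ᶠ[nhds x]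
        fun _ => (1 : Matrix (Fin (N + 1)) (Fin (N + 1)) ℝ) α β := by
      filter_upwards [hU.mem_nhds hx] with y hy
      rw [← Matrix.mul_apply, Matrix.mul_nonsing_inv _ (hdet y hy).isUnit]
    have h2 := pd_congr μ h1
    rw [pd_sum μ fun l _ => (hGd α l).fun_mul (hHd l β)] at h2
    simp only [pd_mul μ (hGd _ _) (hHd _ _)] at h2
    simpa [pd, pdMatrix, Matrix.mul_apply, Finset.sum_add_distrib] using h2
  have h := congrArg ((G x)⁻¹ * ·) key
  simp only [Matrix.mul_add, ← Matrix.mul_assoc, Matrix.mul_zero,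
    Matrix.nonsing_inv_mul _ (hdet x hx).isUnit, Matrix.one_mul] at h
  exact eq_neg_of_add_eq_zero_right h

theorem inv_apply_comm {n : Type*} [Fintype n] [DecidableEq n] {A : Matrix n n ℝ}
    (hA : ∀ α β, A α β = A β α) (α β : n) : A⁻¹ α β = A⁻¹ β α := by
  have h : Aᵀ = A := by ext a b; exact hA b a
  conv_lhs => rw [← h, ← Matrix.transpose_nonsing_inv]
  rfl

/-- The contracted Christoffel symbols
`g^{μν} Γ^l_{μν} = - ∂_μ g^{μl} - (1/2) g^{μl} ∂_μ log |g|`. -/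
theorem contracted_christoffel (hU : IsOpen U)
    (hG : ∀ α β, ContDiffOn ℝ ∞ (fun y => G y α β) U)
    (hdet : ∀ y ∈ U, (G y).det ≠ 0) (hsymm : ∀ y α β, G y α β = G y β α) (hx : x ∈ U)
    (l : Fin (N + 1)) :
    ∑ μ, ∑ ν, (G x)⁻¹ μ ν * christoffel G l μ ν x =
      -∑ μ, pd μ (fun y => (G y)⁻¹ μ l) x
        - (1 / 2) * ∑ μ, (G x)⁻¹ μ l * pd μ (fun y => Real.log |(G y).det|) x := by
  have hGd : ∀ α β, DifferentiableAt ℝ (fun y => G y α β) x := fun α β =>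
    ((hG α β).contDiffAt (hU.mem_nhds hx)).differentiableAt (by simp)
  have hHs := inv_apply_comm (hsymm x)
  have hDs : ∀ μ α β, pdMatrix G μ x α β = pdMatrix G μ x β α := fun μ α β => by
    simp only [pdMatrix, Matrix.of_apply, hsymm _ α β]
  have hinv : ∀ μ, pd μ (fun y => (G y)⁻¹ μ l) x
      = -∑ σ, ∑ ν, (G x)⁻¹ μ ν * pdMatrix G μ x ν σ * (G x)⁻¹ l σ := fun μ => by
    have h := congrFun (congrFun (pdMatrix_inv hU hG hdet hx μ) μ) l
    simp only [pdMatrix, Matrix.neg_apply, Matrix.mul_apply, Finset.sum_mul, Matrix.of_apply] at h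
    simp only [h, hHs l, pdMatrix, Matrix.of_apply]
  simp only [hinv, pd_log_abs_det hGd (hdet x hx), Finset.sum_neg_distrib, neg_neg]
  have hchr : ∀ μ ν, christoffel G l μ ν x = (1 / 2) * ∑ σ, (G x)⁻¹ l σ *
      (pdMatrix G μ x ν σ + pdMatrix G ν x μ σ - pdMatrix G σ x μ ν) := fun μ ν => rfl
  simp only [hchr, Finset.mul_sum]
  -- Against the symmetric `g^{μν}` the first two terms of the Christoffel symbol coincide, so the
  -- factor `1/2` drops and they give the divergence of `g⁻¹`. The third term is the trace in `∂ log
  -- |g|`.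
  have hB : ∑ μ, ∑ ν, ∑ σ, (G x)⁻¹ μ ν * ((G x)⁻¹ l σ * pdMatrix G ν x μ σ)
      = ∑ μ, ∑ ν, ∑ σ, (G x)⁻¹ μ ν * ((G x)⁻¹ l σ * pdMatrix G μ x ν σ) := by
    rw [Finset.sum_comm]
    refine Finset.sum_congr rfl fun a _ => Finset.sum_congr rfl fun b _ => ?_
    rw [hHs b a]
  have hA : ∑ μ, ∑ σ, ∑ ν, (G x)⁻¹ μ ν * pdMatrix G μ x ν σ * (G x)⁻¹ l σ
      = ∑ μ, ∑ ν, ∑ σ, (G x)⁻¹ μ ν * ((G x)⁻¹ l σ * pdMatrix G μ x ν σ) :=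
    Finset.sum_congr rfl fun a _ => by
      rw [Finset.sum_comm]
      exact Finset.sum_congr rfl fun b _ => Finset.sum_congr rfl fun c _ => by ring
  have hC : ∑ σ, ∑ μ, ∑ ν, 1 / 2 * ((G x)⁻¹ σ l * ((G x)⁻¹ μ ν * pdMatrix G σ x ν μ))
      = (1 / 2) * ∑ μ, ∑ ν, ∑ σ, (G x)⁻¹ μ ν * ((G x)⁻¹ l σ * pdMatrix G σ x μ ν) := by
    rw [Finset.sum_comm, Finset.mul_sum]
    refine Finset.sum_congr rfl fun a _ => ?_
    rw [Finset.sum_comm, Finset.mul_sum]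
    refine Finset.sum_congr rfl fun b _ => ?_
    rw [Finset.mul_sum]
    refine Finset.sum_congr rfl fun c _ => ?_
    rw [hDs c b a, hHs c l]
    ring
  rw [hA, hC]
  have hsplit : ∑ μ, ∑ ν, ∑ σ, (G x)⁻¹ μ ν * (1 / 2 * ((G x)⁻¹ l σ *
      (pdMatrix G μ x ν σ + pdMatrix G ν x μ σ - pdMatrix G σ x μ ν)))
      = (1 / 2) * (∑ μ, ∑ ν, ∑ σ, (G x)⁻¹ μ ν * ((G x)⁻¹ l σ * pdMatrix G μ x ν σ)
        + ∑ μ, ∑ ν, ∑ σ, (G x)⁻¹ μ ν * ((G x)⁻¹ l σ * pdMatrix G ν x μ σ)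
        - ∑ μ, ∑ ν, ∑ σ, (G x)⁻¹ μ ν * ((G x)⁻¹ l σ * pdMatrix G σ x μ ν)) := by
    simp only [← Finset.sum_add_distrib, ← Finset.sum_sub_distrib, Finset.mul_sum]
    refine Finset.sum_congr rfl fun a _ => Finset.sum_congr rfl fun b _ =>
      Finset.sum_congr rfl fun c _ => by ring
  rw [hsplit, hB]
  ring

theorem contDiffOn_christoffel (hU : IsOpen U) (hG : ∀ α β, ContDiffOn ℝ ∞ (fun y => G y α β) U)
    (hdet : ∀ y ∈ U, (G y).det ≠ 0) (l μ ν : Fin (N + 1)) :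
    ContDiffOn ℝ ∞ (christoffel G l μ ν) U := by
  unfold christoffel
  exact contDiffOn_const.mul (ContDiffOn.sum fun σ _ => (contDiffOn_matrix_inv hG hdet l σ).mul
    (((contDiffOn_pd hU μ (hG ν σ)).add (contDiffOn_pd hU ν (hG μ σ))).sub
      (contDiffOn_pd hU σ (hG μ ν))))

/-- Only the action on constant spinors is ever differentiated, so smoothness is stated for
functions with values in `ℂ^k`. -/
theorem contDiffOn_spinForm_mulVec {k : ℕ} {e : Fin (N + 1) → Fin (N + 1) → Coord N → ℝ}
    (ρ : CliffordAlgebra (minkowskiForm N) →ₐ[ℝ] Matrix (Fin k) (Fin k) ℂ)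
    (hU : IsOpen U) (hG : ∀ α β, ContDiffOn ℝ ∞ (fun y => G y α β) U)
    (hdet : ∀ y ∈ U, (G y).det ≠ 0) (he : ∀ a μ, ContDiffOn ℝ ∞ (e a μ) U) (μ : Fin (N + 1))
    (v : Fin k → ℂ) : ContDiffOn ℝ ∞ (fun y => spinForm G e ρ μ y *ᵥ v) U := by
  simp only [spinForm, Matrix.sum_mulVec, Matrix.smul_mulVec]
  refine ContDiffOn.sum fun a _ => ContDiffOn.sum fun b _ => ?_
  refine (contDiffOn_const.mul (ContDiffOn.sum fun ν _ => ContDiffOn.sum fun l _ =>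
    ((he a ν).mul (hG ν l)).mul ?_)).smul contDiffOn_const
  unfold covFrame
  exact (contDiffOn_pd hU μ (he b l)).add (ContDiffOn.sum fun σ _ =>
    (contDiffOn_christoffel hU hG hdet l μ σ).mul (he b σ))

end LeviCivita

/-! ### Derivatives of fibrewise quadratic functions and of scalar matrix symbols. -/

section PhaseCalculus

variable {N : ℕ} {c : Fin (N + 1) → Fin (N + 1) → Coord N → ℝ} {z : Phase N}

/-- The fibrewise quadratic function `c^{αβ}(x) ξ_α ξ_β`. -/
noncomputable def fiberQuad (c : Fin (N + 1) → Fin (N + 1) → Coord N → ℝ) (z : Phase N) : ℝ :=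
  ∑ α, ∑ β, c α β z.1 * z.2 α * z.2 β

theorem hasFDerivAt_fiberQuad (hc : ∀ α β, DifferentiableAt ℝ (c α β) z.1) :
    HasFDerivAt (fiberQuad c)
      (∑ α, ∑ β, ((c α β z.1 * z.2 α) • (EuclideanSpace.proj β).comp (ContinuousLinearMap.snd ℝ _ _)
        + z.2 β • (c α β z.1 • (EuclideanSpace.proj α).comp (ContinuousLinearMap.snd ℝ _ _)
          + z.2 α • (fderiv ℝ (c α β) z.1).comp (ContinuousLinearMap.fst ℝ (Coord N) (Coord N))))) z := by
  refine HasFDerivAt.fun_sum fun α _ => HasFDerivAt.fun_sum fun β _ => ?_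
  have h2 : ∀ γ : Fin (N + 1), HasFDerivAt (fun w : Phase N => w.2 γ)
      ((EuclideanSpace.proj γ).comp (ContinuousLinearMap.snd ℝ (Coord N) (Coord N))) z := fun γ =>
    ((EuclideanSpace.proj γ).comp (ContinuousLinearMap.snd ℝ (Coord N) (Coord N))).hasFDerivAt
  have h1 : HasFDerivAt (fun w : Phase N => c α β w.1)
      ((fderiv ℝ (c α β) z.1).comp (ContinuousLinearMap.fst ℝ (Coord N) (Coord N))) z :=
    (hc α β).hasFDerivAt.comp z hasFDerivAt_fst
  exact (h1.mul (h2 α)).mul (h2 β)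

/-- The result is again of the form `fiberQuad`, so `dXi_fiberQuad` applies to it and yields the
mixed derivatives in the subprincipal symbol. -/
theorem dX_fiberQuad (hc : ∀ α β, DifferentiableAt ℝ (c α β) z.1) (μ : Fin (N + 1)) :
    dX μ (fiberQuad c) z = fiberQuad (fun α β => pd μ (c α β)) z := by
  rw [dX, (hasFDerivAt_fiberQuad hc).fderiv]
  simp only [fiberQuad, pd, _root_.sum_apply, _root_.add_apply, _root_.smul_apply, smul_eq_mul,
    ContinuousLinearMap.comp_apply, ContinuousLinearMap.coe_fst', ContinuousLinearMap.coe_snd',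
    map_zero, mul_zero, zero_add]
  exact Finset.sum_congr rfl fun α _ => Finset.sum_congr rfl fun β _ => by ring

theorem dXi_fiberQuad (hc : ∀ α β, DifferentiableAt ℝ (c α β) z.1) (μ : Fin (N + 1)) :
    dXi μ (fiberQuad c) z = ∑ β, (c μ β z.1 + c β μ z.1) * z.2 β := by
  rw [dXi, (hasFDerivAt_fiberQuad hc).fderiv]
  simp [Finset.sum_add_distrib, add_mul]
  rw [add_comm]
  congr 1
  simp [mul_comm]

theorem matDX_ofReal_smul_one {k : ℕ} {q : Phase N → ℝ} (hq : DifferentiableAt ℝ q z)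
    (μ : Fin (N + 1)) :
    matDX μ (fun w => (q w : ℂ) • (1 : Matrix (Fin k) (Fin k) ℂ)) z = ((dX μ q z : ℝ) : ℂ) • 1 := by
  ext a b
  have h : HasFDerivAt (fun w => (q w : ℂ) * (1 : Matrix (Fin k) (Fin k) ℂ) a b) _ z :=
    (Complex.ofRealCLM.hasFDerivAt.comp z hq.hasFDerivAt).mul_const _
  simp only [matDX, dX, Matrix.of_apply, Matrix.smul_apply, smul_eq_mul, h.fderiv]
  simp [mul_comm]

theorem matDXi_ofReal_smul_one {k : ℕ} {q : Phase N → ℝ} (hq : DifferentiableAt ℝ q z)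
    (μ : Fin (N + 1)) :
    matDXi μ (fun w => (q w : ℂ) • (1 : Matrix (Fin k) (Fin k) ℂ)) z = ((dXi μ q z : ℝ) : ℂ) • 1 := by
  ext a b
  have h : HasFDerivAt (fun w => (q w : ℂ) * (1 : Matrix (Fin k) (Fin k) ℂ) a b) _ z :=
    (Complex.ofRealCLM.hasFDerivAt.comp z hq.hasFDerivAt).mul_const _
  simp only [matDXi, dXi, Matrix.of_apply, Matrix.smul_apply, smul_eq_mul, h.fderiv]
  simp [mul_comm]

theorem matDX_congr {k : ℕ} {F F' : Phase N → Matrix (Fin k) (Fin k) ℂ} (h : F =ᶠ[nhds z] F')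
    (μ : Fin (N + 1)) : matDX μ F z = matDX μ F' z := by
  ext a b
  have h' : (fun w => F w a b) =ᶠ[nhds z] fun w => F' w a b := h.mono fun w hw => by
    simp only [hw]
  simp only [matDX, dX, Matrix.of_apply, h'.fderiv_eq]

theorem matDXi_congr {k : ℕ} {F F' : Phase N → Matrix (Fin k) (Fin k) ℂ} (h : F =ᶠ[nhds z] F')
    (μ : Fin (N + 1)) : matDXi μ F z = matDXi μ F' z := by
  ext a b
  have h' : (fun w => F w a b) =ᶠ[nhds z] fun w => F' w a b := h.mono fun w hw => by
    simp only [hw]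
  simp only [matDXi, dXi, Matrix.of_apply, h'.fderiv_eq]

theorem matBracket_one_left {k : ℕ} (B : Phase N → Matrix (Fin k) (Fin k) ℂ) :
    matBracket (fun _ => 1) B z = 0 := by
  have h1 : ∀ μ, matDX μ (fun _ : Phase N => (1 : Matrix (Fin k) (Fin k) ℂ)) z = 0 := fun μ => by
    ext a b; simp [matDX, dX]
  have h2 : ∀ μ, matDXi μ (fun _ : Phase N => (1 : Matrix (Fin k) (Fin k) ℂ)) z = 0 := fun μ => by
    ext a b; simp [matDXi, dXi]
  simp [matBracket, h1, h2]

end PhaseCalculus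

/-! ### Homogeneous terms of a quadratic symbol. -/

section SymbolTerm

theorem iteratedDeriv_quadratic_zero {F : ℝ → ℂ} {α β γ : ℂ}
    (hF : ∀ t : ℝ, F t = (t : ℂ) ^ 2 * α + t * β + γ) :
    iteratedDeriv 2 F 0 = 2 * α ∧ iteratedDeriv 1 F 0 = β ∧ iteratedDeriv 0 F 0 = γ := by
  have hid : ∀ t : ℝ, HasDerivAt (fun s : ℝ => (s : ℂ)) 1 t := fun t => Complex.ofRealCLM.hasDerivAt
  have h1 : ∀ t : ℝ, HasDerivAt F (2 * t * α + β) t := fun t => by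
    rw [funext hF]
    simpa using ((((hid t).pow 2).mul_const α).add ((hid t).mul_const β)).add_const γ
  have h1' : deriv F = fun t : ℝ => 2 * (t : ℂ) * α + β := funext fun t => (h1 t).deriv
  have h2 : HasDerivAt (fun t : ℝ => 2 * (t : ℂ) * α + β) (2 * α) 0 := by
    simpa using (((hid 0).const_mul 2).mul_const α).add_const β
  refine ⟨?_, ?_, ?_⟩
  · rw [iteratedDeriv_succ, iteratedDeriv_one, h1', h2.deriv]
  · simp [iteratedDeriv_one, h1']
  · simp [hF]

variable {N k : ℕ}

/-- Along a ray `t ↦ (x, tξ)` the Taylor coefficients at `0` separate the degrees. Taking `σ (x, 0)`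
as the constant term avoids computing the degree zero part explicitly. -/
theorem symbolTerm_quadratic {σ A B : Phase N → Matrix (Fin k) (Fin k) ℂ} {z : Phase N}
    (h : ∀ ξ, σ (z.1, ξ) = A (z.1, ξ) + B (z.1, ξ) + σ (z.1, 0))
    (hA : ∀ t : ℝ, A (z.1, t • z.2) = (t : ℂ) ^ 2 • A z)
    (hB : ∀ t : ℝ, B (z.1, t • z.2) = (t : ℂ) • B z) :
    symbolTerm 2 σ 0 z = A z ∧ symbolTerm 2 σ 1 z = B z ∧ symbolTerm 2 σ 2 z = σ (z.1, 0) := by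
  have hF : ∀ a b, ∀ t : ℝ, σ (z.1, t • z.2) a b
      = (t : ℂ) ^ 2 * A z a b + t * B z a b + σ (z.1, 0) a b := fun a b t => by
    rw [h, hA, hB]; rfl
  refine ⟨?_, ?_, ?_⟩ <;> ext a b <;> obtain ⟨h2, h1, -⟩ := iteratedDeriv_quadratic_zero (hF a b)
  · simp [symbolTerm, h2]
  · simp [symbolTerm, ← h1]
  · simp [symbolTerm]

end SymbolTerm

/-! ### The full symbol of the Klein-Gordon operator. -/

section KleinGordonSymbol

variable {N k : ℕ} {G : Coord N → Matrix (Fin (N + 1)) (Fin (N + 1)) ℝ}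
  {e : Fin (N + 1) → Fin (N + 1) → Coord N → ℝ}
  {ρ : CliffordAlgebra (minkowskiForm N) →ₐ[ℝ] Matrix (Fin k) (Fin k) ℂ}

/-- The plane wave `e^{i y ξ}`. -/
noncomputable def planeWave (ξ y : Coord N) : ℂ :=
  Complex.exp (Complex.I * ((∑ μ, y μ * ξ μ : ℝ) : ℂ))

/-- The amplitude `w` is not constant because the second covariant derivative acts on the plane wave
times the symbol of the first. -/
theorem pd_planeWave_smul (ξ : Coord N) {w : Coord N → Fin k → ℂ} {x : Coord N}
    (hw : DifferentiableAt ℝ w x) (μ : Fin (N + 1)) :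
    pd μ (fun y => planeWave ξ y • w y) x =
      planeWave ξ x • ((Complex.I * (ξ μ : ℂ)) • w x + pd μ w x) := by
  have hl : HasFDerivAt (fun y : Coord N => ∑ ν, y ν * ξ ν)
      (∑ ν, ξ ν • (EuclideanSpace.proj ν : Coord N →L[ℝ] ℝ)) x :=
    HasFDerivAt.fun_sum fun ν _ =>
      (EuclideanSpace.proj ν : Coord N →L[ℝ] ℝ).hasFDerivAt.mul_const (ξ ν)
  have hE : HasFDerivAt (planeWave ξ) _ x :=
    ((Complex.ofRealCLM.hasFDerivAt.comp x hl).const_mul Complex.I).cexp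
  rw [pd, (hE.fun_smul hw.hasFDerivAt).fderiv]
  simp [pd, planeWave, smul_smul, smul_add, add_comm, mul_assoc]

/-- The symbol of `∇_ν` applied to a constant spinor `v`. -/
noncomputable def covSymbol (G : Coord N → Matrix (Fin (N + 1)) (Fin (N + 1)) ℝ)
    (e : Fin (N + 1) → Fin (N + 1) → Coord N → ℝ)
    (ρ : CliffordAlgebra (minkowskiForm N) →ₐ[ℝ] Matrix (Fin k) (Fin k) ℂ) (ξ : Coord N)
    (v : Fin k → ℂ) (ν : Fin (N + 1)) (y : Coord N) : Fin k → ℂ :=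
  (Complex.I * (ξ ν : ℂ)) • v + spinForm G e ρ ν y *ᵥ v

theorem covSpinor_planeWave_smul (ξ : Coord N) {w : Coord N → Fin k → ℂ} {x : Coord N}
    (hw : DifferentiableAt ℝ w x) (μ : Fin (N + 1)) :
    covSpinor G e ρ μ (fun y => planeWave ξ y • w y) x =
      planeWave ξ x • ((Complex.I * (ξ μ : ℂ)) • w x + pd μ w x + spinForm G e ρ μ x *ᵥ w x) := by
  rw [covSpinor, pd_planeWave_smul ξ hw, Matrix.mulVec_smul, ← smul_add]

theorem covSpinor_planeWave_smul_const (ξ : Coord N) (v : Fin k → ℂ) (ν : Fin (N + 1)) :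
    covSpinor G e ρ ν (fun y => planeWave ξ y • v) =
      fun y => planeWave ξ y • covSymbol G e ρ ξ v ν y := by
  funext y
  rw [covSpinor_planeWave_smul ξ (w := fun _ => v) (differentiableAt_const v)]
  simp [covSymbol, pd]

theorem pd_covSymbol (ξ : Coord N) (v : Fin k → ℂ) (μ ν : Fin (N + 1)) (x : Coord N) :
    pd μ (covSymbol G e ρ ξ v ν) x = pd μ (fun y => spinForm G e ρ ν y *ᵥ v) x := by
  have h : covSymbol G e ρ ξ v ν =
      fun y => (Complex.I * (ξ ν : ℂ)) • v + spinForm G e ρ ν y *ᵥ v := rfl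
  rw [h, pd, fderiv_const_add, pd]

/-- The symbol of the Klein-Gordon operator applied to a constant spinor `v`. -/
noncomputable def kleinGordonSymbolVec (G : Coord N → Matrix (Fin (N + 1)) (Fin (N + 1)) ℝ)
    (e : Fin (N + 1) → Fin (N + 1) → Coord N → ℝ)
    (ρ : CliffordAlgebra (minkowskiForm N) →ₐ[ℝ] Matrix (Fin k) (Fin k) ℂ) (m : ℝ)
    (x ξ : Coord N) (v : Fin k → ℂ) : Fin k → ℂ :=
  ∑ μ, ∑ ν, (G x)⁻¹ μ ν • ((Complex.I * (ξ μ : ℂ)) • covSymbol G e ρ ξ v ν x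
      + pd μ (fun y => spinForm G e ρ ν y *ᵥ v) x + spinForm G e ρ μ x *ᵥ covSymbol G e ρ ξ v ν x
      - ∑ l, christoffel G l μ ν x • covSymbol G e ρ ξ v l x)
    + ((1 / 4) * scalarCurvature G x + m ^ 2) • v

theorem kleinGordon_planeWave_smul (m : ℝ) (ξ : Coord N) (v : Fin k → ℂ) {x : Coord N}
    (hS : ∀ ν, DifferentiableAt ℝ (fun y => spinForm G e ρ ν y *ᵥ v) x) :
    kleinGordon G e ρ m (fun y => planeWave ξ y • v) x =
      planeWave ξ x • kleinGordonSymbolVec G e ρ m x ξ v := by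
  have hw : ∀ ν, DifferentiableAt ℝ (covSymbol G e ρ ξ v ν) x := fun ν => (hS ν).const_add _
  simp only [kleinGordon, covSpinor_planeWave_smul_const, covSpinor_planeWave_smul ξ (hw _),
    pd_covSymbol, kleinGordonSymbolVec, smul_add, Finset.smul_sum, smul_sub,
    smul_comm (planeWave ξ x) (_ : ℝ)]

theorem fullSymbol_kleinGordon_apply (m : ℝ) {z : Phase N}
    (hS : ∀ ν v, DifferentiableAt ℝ (fun y => spinForm G e ρ ν y *ᵥ v) z.1) (a b : Fin k) :
    fullSymbol (kleinGordon G e ρ m) z a b =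
      kleinGordonSymbolVec G e ρ m z.1 z.2 (Pi.single b 1) a := by
  have h := kleinGordon_planeWave_smul m z.2 (Pi.single b 1) (fun ν => hS ν _)
  simp only [planeWave] at h
  simp only [fullSymbol, Matrix.of_apply, h, Pi.smul_apply, smul_eq_mul]
  rw [← mul_assoc, ← Complex.exp_add]
  simp

/-- The first order term of the symbol of the Klein-Gordon operator. -/
noncomputable def kleinGordonSymbolOne (G : Coord N → Matrix (Fin (N + 1)) (Fin (N + 1)) ℝ)
    (e : Fin (N + 1) → Fin (N + 1) → Coord N → ℝ)
    (ρ : CliffordAlgebra (minkowskiForm N) →ₐ[ℝ] Matrix (Fin k) (Fin k) ℂ) (z : Phase N) :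
    Matrix (Fin k) (Fin k) ℂ :=
  Complex.I • ∑ μ, ∑ ν, (G z.1)⁻¹ μ ν • (z.2 μ • spinForm G e ρ ν z.1
    + z.2 ν • spinForm G e ρ μ z.1
    - (∑ l, christoffel G l μ ν z.1 * z.2 l) • (1 : Matrix (Fin k) (Fin k) ℂ))

/-- Sorting by degree in `ξ`: everything of degree zero is the value at `ξ = 0`, so it cancels
without being evaluated. -/
theorem kleinGordonSymbolVec_eq (m : ℝ) (z : Phase N) (v : Fin k → ℂ) :
    kleinGordonSymbolVec G e ρ m z.1 z.2 v =
      (((metricSymbol G z : ℂ) • (1 : Matrix (Fin k) (Fin k) ℂ)) + kleinGordonSymbolOne G e ρ z) *ᵥ v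
        + kleinGordonSymbolVec G e ρ m z.1 0 v := by
  ext a
  simp only [kleinGordonSymbolVec, kleinGordonSymbolOne, metricSymbol, covSymbol, Matrix.add_mulVec,
    Matrix.sub_mulVec, Matrix.smul_mulVec, Matrix.sum_mulVec, Matrix.one_mulVec, Pi.add_apply,
    Pi.sub_apply, Pi.smul_apply, Finset.sum_apply, Matrix.mulVec_add, Matrix.mulVec_smul,
    Complex.real_smul, smul_eq_mul, PiLp.zero_apply, Complex.ofReal_zero, mul_zero, zero_mul,
    zero_add, Complex.ofReal_neg, Complex.ofReal_sum, Complex.ofReal_mul, neg_mul]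
  rw [← add_assoc]
  congr 1
  rw [Finset.sum_mul, Finset.mul_sum, ← Finset.sum_neg_distrib, ← Finset.sum_add_distrib,
    ← Finset.sum_add_distrib]
  refine Finset.sum_congr rfl fun μ _ => ?_
  rw [Finset.sum_mul, Finset.mul_sum, ← Finset.sum_neg_distrib, ← Finset.sum_add_distrib,
    ← Finset.sum_add_distrib]
  refine Finset.sum_congr rfl fun ν _ => ?_
  have hl : ∑ l, (christoffel G l μ ν z.1 : ℂ) *
      (Complex.I * (z.2 l : ℂ) * v a + (spinForm G e ρ l z.1 *ᵥ v) a)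
      = Complex.I * ((∑ l, (christoffel G l μ ν z.1 : ℂ) * (z.2 l : ℂ)) * v a)
        + ∑ l, (christoffel G l μ ν z.1 : ℂ) * (spinForm G e ρ l z.1 *ᵥ v) a := by
    rw [Finset.sum_mul, Finset.mul_sum, ← Finset.sum_add_distrib]
    exact Finset.sum_congr rfl fun l _ => by ring
  rw [hl]
  -- `i² = -1` is needed only for the quadratic term `(iξ_μ)(iξ_ν)`.
  linear_combination ((G z.1)⁻¹ μ ν : ℂ) * (z.2 μ : ℂ) * (z.2 ν : ℂ) * v a * Complex.I_sq

theorem fullSymbol_kleinGordon_eq (m : ℝ) {z : Phase N}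
    (hS : ∀ ν v, DifferentiableAt ℝ (fun y => spinForm G e ρ ν y *ᵥ v) z.1) :
    fullSymbol (kleinGordon G e ρ m) z =
      (metricSymbol G z : ℂ) • (1 : Matrix (Fin k) (Fin k) ℂ) + kleinGordonSymbolOne G e ρ z
        + fullSymbol (kleinGordon G e ρ m) (z.1, 0) := by
  ext a b
  rw [fullSymbol_kleinGordon_apply m hS, kleinGordonSymbolVec_eq, Matrix.add_apply,
    fullSymbol_kleinGordon_apply (z := (z.1, 0)) m hS]
  simp

theorem symbolTerm_kleinGordon (m : ℝ) {z : Phase N}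
    (hS : ∀ ν v, DifferentiableAt ℝ (fun y => spinForm G e ρ ν y *ᵥ v) z.1) :
    symbolTerm 2 (fullSymbol (kleinGordon G e ρ m)) 0 z =
        (metricSymbol G z : ℂ) • (1 : Matrix (Fin k) (Fin k) ℂ) ∧
      symbolTerm 2 (fullSymbol (kleinGordon G e ρ m)) 1 z = kleinGordonSymbolOne G e ρ z ∧
      symbolTerm 2 (fullSymbol (kleinGordon G e ρ m)) 2 z =
        fullSymbol (kleinGordon G e ρ m) (z.1, 0) := by
  refine symbolTerm_quadratic (A := fun z => (metricSymbol G z : ℂ) • 1)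
    (B := kleinGordonSymbolOne G e ρ)
    (fun ξ => fullSymbol_kleinGordon_eq (z := (z.1, ξ)) m hS) (fun t => ?_) (fun t => ?_)
  · rw [smul_smul]
    congr 1
    have : metricSymbol G (z.1, t • z.2) = t ^ 2 * metricSymbol G z := by
      simp only [metricSymbol, PiLp.smul_apply, smul_eq_mul, mul_neg, Finset.mul_sum]
      congr 1
      exact Finset.sum_congr rfl fun μ _ => Finset.sum_congr rfl fun ν _ => by ring
    rw [this]
    push_cast
    rfl
  · simp only [kleinGordonSymbolOne]
    rw [smul_comm (t : ℂ) Complex.I]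
    congr 1
    rw [Finset.smul_sum]
    refine Finset.sum_congr rfl fun μ _ => ?_
    rw [Finset.smul_sum]
    refine Finset.sum_congr rfl fun ν _ => ?_
    rw [show ((t : ℂ) • _ : Matrix (Fin k) (Fin k) ℂ) = t • _ from Complex.coe_smul t _,
      smul_comm t ((G z.1)⁻¹ μ ν)]
    congr 1
    simp only [PiLp.smul_apply, smul_eq_mul, smul_add, smul_sub, smul_smul, Finset.mul_sum,
      mul_left_comm]

end KleinGordonSymbol

/-! ### Tangency of the Hamiltonian vector field and the Leibniz rule. -/

section Hamiltonian

variable {N : ℕ} {q u : Phase N → ℝ} {z : Phase N}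

theorem phase_clm_apply (L : Phase N →L[ℝ] ℝ) (w : Phase N) :
    L w = ∑ μ, (w.1 μ * L (basisVec μ, 0) + w.2 μ * L (0, basisVec μ)) := by
  have h : ∀ v : Coord N, v = ∑ μ, v μ • (basisVec μ : Coord N) := fun v => by
    simpa using ((EuclideanSpace.basisFun (Fin (N + 1)) ℝ).sum_repr v).symm
  have hw : w = ∑ μ, (w.1 μ • ((basisVec μ, 0) : Phase N) + w.2 μ • ((0, basisVec μ) : Phase N)) := by
    refine Prod.ext ?_ ?_
    · simpa [Prod.fst_sum] using h w.1
    · simpa [Prod.snd_sum] using h w.2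
  conv_lhs => rw [hw]
  rw [map_sum]
  exact Finset.sum_congr rfl fun μ _ => by rw [map_add, map_smul, map_smul, smul_eq_mul, smul_eq_mul]

theorem fderiv_hamVec_self : fderiv ℝ q z (hamVec q z) = 0 := by
  rw [phase_clm_apply]
  refine Finset.sum_eq_zero fun μ _ => ?_
  simp only [hamVec, dX, dXi]
  ring

/-- The Hamiltonian vector field of `q` is tangent to the level sets of `q`. -/
theorem fderiv_hamVec_eq_zero (hq : ContDiffAt ℝ 1 q z) (hu : ContDiffAt ℝ 1 u z)
    (h : ∀ᶠ w in nhds z, q w = q z → u w = u z) : fderiv ℝ u z (hamVec q z) = 0 := by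
  -- A function constant on the level set has a local extremum there, so Lagrange multipliers give a
  -- nontrivial relation `a dq + b du = 0`.
  have hext : IsLocalExtrOn u {w | q w = q z} z := by
    left
    refine eventually_nhdsWithin_iff.2 (h.mono fun w hw hmem => ?_)
    exact (hw hmem).ge
  obtain ⟨a, b, hab, hsum⟩ := hext.exists_multipliers_of_hasStrictFDerivAt_1d
    (hq.hasStrictFDerivAt one_ne_zero) (hu.hasStrictFDerivAt one_ne_zero)
  have happ : ∀ v, a * fderiv ℝ q z v + b * fderiv ℝ u z v = 0 := fun v => by
    simpa using DFunLike.congr_fun hsum v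
  -- If `b = 0`, then `dq = 0` and `X_q` vanishes at `z`. Otherwise `du` is a multiple of `dq`,
  -- which kills `X_q`.
  by_cases hb : b = 0
  · have ha : a ≠ 0 := fun ha => hab (by rw [ha, hb]; rfl)
    have hz : ∀ v, fderiv ℝ q z v = 0 := fun v => by simpa [hb, ha] using happ v
    have : hamVec q z = 0 := by
      refine Prod.ext ?_ ?_ <;> ext μ <;> simp [hamVec, dX, dXi, hz]
    rw [this, map_zero]
  · have h0 := happ (hamVec q z)
    rw [fderiv_hamVec_self] at h0
    simpa [hb] using h0

/-- The scalar tangency statement applied to the real and imaginary parts of the components of `f₁ -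
f₂`. -/
theorem fderiv_hamVec_congr {k : ℕ} {f₁ f₂ : Phase N → Fin k → ℂ} (hq : ContDiffAt ℝ 1 q z)
    (h₁ : ContDiffAt ℝ 1 f₁ z) (h₂ : ContDiffAt ℝ 1 f₂ z) (hz : f₁ z = f₂ z)
    (h : ∀ᶠ w in nhds z, q w = q z → f₁ w = f₂ w) :
    fderiv ℝ f₁ z (hamVec q z) = fderiv ℝ f₂ z (hamVec q z) := by
  have key : ∀ L : (Fin k → ℂ) →L[ℝ] ℝ, L (fderiv ℝ (fun w => f₁ w - f₂ w) z (hamVec q z)) = 0 := by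
    intro L
    have hu := L.contDiff.contDiffAt.comp z (h₁.sub h₂)
    have h0 := fderiv_hamVec_eq_zero hq hu (h.mono fun w hw hmem => by
      simp [hw hmem, hz])
    have hd : DifferentiableAt ℝ (fun w => f₁ w - f₂ w) z :=
      (h₁.differentiableAt one_ne_zero).fun_sub (h₂.differentiableAt one_ne_zero)
    rw [← h0]
    exact (DFunLike.congr_fun (L.hasFDerivAt.comp z hd.hasFDerivAt).fderiv (hamVec q z)).symm
  have hsub : fderiv ℝ (fun w => f₁ w - f₂ w) z (hamVec q z) = 0 := by
    ext a
    refine Complex.ext ?_ ?_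
    · exact key (Complex.reCLM.comp (ContinuousLinearMap.proj a))
    · exact key (Complex.imCLM.comp (ContinuousLinearMap.proj a))
  rw [fderiv_fun_sub (h₁.differentiableAt one_ne_zero) (h₂.differentiableAt one_ne_zero)] at hsub
  exact sub_eq_zero.1 hsub

theorem pullbackCov_smul {k : ℕ} (A : Fin (N + 1) → Coord N → Matrix (Fin k) (Fin k) ℂ)
    (Y : Phase N → Phase N) {h : Phase N → ℂ} {f : Phase N → Fin k → ℂ}
    (hh : DifferentiableAt ℝ h z) (hf : DifferentiableAt ℝ f z) :
    pullbackCov A Y (fun w => h w • f w) z = fderiv ℝ h z (Y z) • f z + h z • pullbackCov A Y f z := by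
  have hs : fderiv ℝ (fun w => h w • f w) z (Y z)
      = h z • fderiv ℝ f z (Y z) + fderiv ℝ h z (Y z) • f z := by
    rw [(hh.hasFDerivAt.fun_smul hf.hasFDerivAt).fderiv]
    simp
  simp only [pullbackCov, hs, Matrix.mulVec_smul, smul_add, Finset.smul_sum]
  simp only [smul_comm (h z) (_ : ℝ)]
  abel

end Hamiltonian

/-! ### Derivatives of the metric symbol and the half-density form. -/

section MetricSymbol

variable {N : ℕ} {G : Coord N → Matrix (Fin (N + 1)) (Fin (N + 1)) ℝ} {U : Set (Coord N)}
  {z : Phase N}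

theorem metricSymbol_eq_fiberQuad :
    metricSymbol G = fiberQuad fun α β y => -(G y)⁻¹ α β := by
  funext z
  simp [metricSymbol, fiberQuad]

theorem isOpen_fst_mem (hU : IsOpen U) : IsOpen {z : Phase N | z.1 ∈ U} :=
  hU.preimage continuous_fst

theorem contDiffOn_metricSymbol (hG : ∀ α β, ContDiffOn ℝ ∞ (fun y => G y α β) U)
    (hdet : ∀ y ∈ U, (G y).det ≠ 0) :
    ContDiffOn ℝ ∞ (metricSymbol G) {z : Phase N | z.1 ∈ U} := by
  have h2 : ∀ α : Fin (N + 1), ContDiff ℝ ∞ fun z : Phase N => z.2 α := fun α =>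
    ((EuclideanSpace.proj α).comp (ContinuousLinearMap.snd ℝ (Coord N) (Coord N))).contDiff
  unfold metricSymbol
  exact (ContDiffOn.sum fun α _ => ContDiffOn.sum fun β _ =>
    (((contDiffOn_matrix_inv hG hdet α β).comp contDiffOn_fst fun _ h => h).mul
      (h2 α).contDiffOn).mul (h2 β).contDiffOn).neg

theorem dXi_metricSymbol (hU : IsOpen U) (hG : ∀ α β, ContDiffOn ℝ ∞ (fun y => G y α β) U)
    (hdet : ∀ y ∈ U, (G y).det ≠ 0) (hsymm : ∀ y α β, G y α β = G y β α) (hz : z.1 ∈ U)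
    (μ : Fin (N + 1)) :
    dXi μ (metricSymbol G) z = -2 * ∑ β, (G z.1)⁻¹ μ β * z.2 β := by
  rw [metricSymbol_eq_fiberQuad,
    dXi_fiberQuad fun α β => (differentiableAt_inv_apply hU hG hdet hz α β).fun_neg, Finset.mul_sum]
  refine Finset.sum_congr rfl fun β _ => ?_
  rw [inv_apply_comm (hsymm z.1) β μ]
  ring

theorem dX_metricSymbol (hU : IsOpen U) (hG : ∀ α β, ContDiffOn ℝ ∞ (fun y => G y α β) U)
    (hdet : ∀ y ∈ U, (G y).det ≠ 0) (hz : z.1 ∈ U) (μ : Fin (N + 1)) :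
    dX μ (metricSymbol G) z = fiberQuad (fun α β => pd μ fun y => -(G y)⁻¹ α β) z := by
  rw [metricSymbol_eq_fiberQuad,
    dX_fiberQuad fun α β => (differentiableAt_inv_apply hU hG hdet hz α β).fun_neg]

theorem differentiableAt_pd_neg_inv (hU : IsOpen U)
    (hG : ∀ α β, ContDiffOn ℝ ∞ (fun y => G y α β) U) (hdet : ∀ y ∈ U, (G y).det ≠ 0)
    (hz : z.1 ∈ U) (μ α β : Fin (N + 1)) :
    DifferentiableAt ℝ (pd μ fun y => -(G y)⁻¹ α β) z.1 :=
  ((contDiffOn_pd hU μ (contDiffOn_matrix_inv hG hdet α β).neg).contDiffAt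
    (hU.mem_nhds hz)).differentiableAt (by simp)

theorem dXi_dX_metricSymbol (hU : IsOpen U) (hG : ∀ α β, ContDiffOn ℝ ∞ (fun y => G y α β) U)
    (hdet : ∀ y ∈ U, (G y).det ≠ 0) (hsymm : ∀ y α β, G y α β = G y β α) (hz : z.1 ∈ U)
    (μ : Fin (N + 1)) :
    dXi μ (dX μ (metricSymbol G)) z = -2 * ∑ β, pd μ (fun y => (G y)⁻¹ μ β) z.1 * z.2 β := by
  have hc : dX μ (metricSymbol G) =ᶠ[nhds z]
      fiberQuad (fun α β => pd μ fun y => -(G y)⁻¹ α β) := by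
    filter_upwards [(isOpen_fst_mem hU).mem_nhds hz] with w hw
    exact dX_metricSymbol hU hG hdet hw μ
  rw [dXi, hc.fderiv_eq, ← dXi,
    dXi_fiberQuad fun α β => differentiableAt_pd_neg_inv hU hG hdet hz μ α β, Finset.mul_sum]
  refine Finset.sum_congr rfl fun β _ => ?_
  have hs : (fun y => -(G y)⁻¹ β μ) = fun y => -(G y)⁻¹ μ β :=
    funext fun y => by rw [inv_apply_comm (hsymm y)]
  have hn : pd μ (fun y => -(G y)⁻¹ μ β) z.1 = -pd μ (fun y => (G y)⁻¹ μ β) z.1 := by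
    simp only [pd, fderiv_fun_neg, _root_.neg_apply]
  rw [hs, hn]
  ring

/-- The `ξ`-gradient is `-2 g⁻¹ ξ`, and `g⁻¹` is injective. -/
theorem exists_dXi_metricSymbol_ne_zero (hU : IsOpen U)
    (hG : ∀ α β, ContDiffOn ℝ ∞ (fun y => G y α β) U) (hdet : ∀ y ∈ U, (G y).det ≠ 0)
    (hsymm : ∀ y α β, G y α β = G y β α) (hz : z.1 ∈ U) (hξ : z.2 ≠ 0) :
    ∃ μ, dXi μ (metricSymbol G) z ≠ 0 := by
  by_contra! h
  apply hξ
  have h0 : (G z.1)⁻¹ *ᵥ z.2.ofLp = 0 := by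
    funext μ
    have := h μ
    rw [dXi_metricSymbol hU hG hdet hsymm hz] at this
    simpa [Matrix.mulVec, dotProduct] using this
  have h1 := congrArg ((G z.1) *ᵥ ·) h0
  simp only [Matrix.mulVec_mulVec, Matrix.mul_nonsing_inv _ (hdet _ hz).isUnit, Matrix.one_mulVec,
    Matrix.mulVec_zero] at h1
  ext μ
  exact congrFun h1 μ

/-- The scalar part of the subprincipal symbol is the half-density connection form. -/
theorem sum_dXi_mul_halfDensityForm (hU : IsOpen U)
    (hG : ∀ α β, ContDiffOn ℝ ∞ (fun y => G y α β) U) (hdet : ∀ y ∈ U, (G y).det ≠ 0)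
    (hsymm : ∀ y α β, G y α β = G y β α) (hz : z.1 ∈ U) :
    ∑ μ, dXi μ (metricSymbol G) z * halfDensityForm G μ z.1 =
      ∑ μ, ∑ ν, (G z.1)⁻¹ μ ν * ∑ l, christoffel G l μ ν z.1 * z.2 l
        - (1 / 2) * ∑ μ, dXi μ (dX μ (metricSymbol G)) z := by
  have h1 : ∑ μ, ∑ ν, (G z.1)⁻¹ μ ν * ∑ l, christoffel G l μ ν z.1 * z.2 l
      = ∑ l, (∑ μ, ∑ ν, (G z.1)⁻¹ μ ν * christoffel G l μ ν z.1) * z.2 l := by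
    simp only [Finset.mul_sum, Finset.sum_mul]
    rw [Finset.sum_comm]
    conv_rhs => rw [Finset.sum_comm]
    rw [Finset.sum_comm]
    refine Finset.sum_congr rfl fun μ _ => ?_
    rw [Finset.sum_comm]
    exact Finset.sum_congr rfl fun l _ => Finset.sum_congr rfl fun ν _ => by ring
  -- The mixed derivative of `q` is `-2 ∂_μ g^{μβ} ξ_β`, and its multiple by `-1/2` cancels the
  -- divergence in the contracted Christoffel symbols. The coefficients of `∂ log |g|` then match,
  -- since `-2 · 1/4 = -1/2`.
  simp only [h1, contracted_christoffel hU hG hdet hsymm hz, dXi_metricSymbol hU hG hdet hsymm hz,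
    dXi_dX_metricSymbol hU hG hdet hsymm hz, halfDensityForm]
  simp only [sub_mul, neg_mul, Finset.sum_mul, Finset.mul_sum, Finset.sum_sub_distrib,
    Finset.sum_neg_distrib, mul_neg]
  rw [Finset.sum_comm (f := fun l μ => pd μ (fun y => (G y)⁻¹ μ l) z.1 * z.2 l),
    Finset.sum_comm (f := fun l μ => 1 / 2 * ((G z.1)⁻¹ μ l *
      pd μ (fun y => Real.log |(G y).det|) z.1) * z.2 l)]
  have h2 : ∀ a b : ℝ, (1 / 2) * (2 * (a * b)) = a * b := fun a b => by ring
  simp only [h2, sub_neg_eq_add]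
  have h3 : ∑ μ, ∑ ν, 2 * ((G z.1)⁻¹ μ ν * z.2 ν) *
      (1 / 4 * pd μ (fun y => Real.log |(G y).det|) z.1)
      = ∑ μ, ∑ ν, 1 / 2 * ((G z.1)⁻¹ μ ν * pd μ (fun y => Real.log |(G y).det|) z.1) * z.2 ν :=
    Finset.sum_congr rfl fun μ _ => Finset.sum_congr rfl fun ν _ => by ring
  linear_combination -h3

end MetricSymbol

/-! ### The Dencker connection as a pulled back connection. -/

section Dencker

variable {N k : ℕ} {G : Coord N → Matrix (Fin (N + 1)) (Fin (N + 1)) ℝ} {U : Set (Coord N)}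
  {e : Fin (N + 1) → Fin (N + 1) → Coord N → ℝ}
  (ρ : CliffordAlgebra (minkowskiForm N) →ₐ[ℝ] Matrix (Fin k) (Fin k) ℂ) (m : ℝ) {z : Phase N}

/-- The formula for `p_0` is known only over the open set `U`, so both derivatives are transferred
through equality of germs. -/
theorem subprincipal_kleinGordon (hU : IsOpen U) (hG : ∀ α β, ContDiffOn ℝ ∞ (fun y => G y α β) U)
    (hdet : ∀ y ∈ U, (G y).det ≠ 0) (he : ∀ a μ, ContDiffOn ℝ ∞ (e a μ) U) (hz : z.1 ∈ U) :
    subprincipal (symbolTerm 2 (fullSymbol (kleinGordon G e ρ m)) 0)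
        (symbolTerm 2 (fullSymbol (kleinGordon G e ρ m)) 1) z =
      kleinGordonSymbolOne G e ρ z
        + (Complex.I / 2) • ((∑ μ, dXi μ (dX μ (metricSymbol G)) z : ℝ) : ℂ) • 1 := by
  have hS : ∀ y ∈ U, ∀ ν v, DifferentiableAt ℝ (fun y => spinForm G e ρ ν y *ᵥ v) y :=
    fun y hy ν v => ((contDiffOn_spinForm_mulVec ρ hU hG hdet he ν v).contDiffAt
      (hU.mem_nhds hy)).differentiableAt (by simp)
  have hΩ := isOpen_fst_mem (N := N) hU
  have hq : ∀ w : Phase N, w.1 ∈ U → DifferentiableAt ℝ (metricSymbol G) w := fun w hw =>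
    ((contDiffOn_metricSymbol hG hdet).contDiffAt (hΩ.mem_nhds hw)).differentiableAt (by simp)
  have hdX : ∀ μ, matDX μ (symbolTerm 2 (fullSymbol (kleinGordon G e ρ m)) 0) =ᶠ[nhds z]
      fun w => ((dX μ (metricSymbol G) w : ℝ) : ℂ) • (1 : Matrix (Fin k) (Fin k) ℂ) := fun μ => by
    filter_upwards [hΩ.mem_nhds hz] with w hw
    rw [← matDX_ofReal_smul_one (hq w hw)]
    refine matDX_congr ?_ μ
    filter_upwards [hΩ.mem_nhds hw] with w' hw'
    exact (symbolTerm_kleinGordon m (hS _ hw')).1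
  have hdq : ∀ μ, DifferentiableAt ℝ (dX μ (metricSymbol G)) z := fun μ => by
    have h := (hasFDerivAt_fiberQuad fun α β =>
      differentiableAt_pd_neg_inv hU hG hdet hz μ α β).differentiableAt
    refine h.congr_of_eventuallyEq ?_
    filter_upwards [hΩ.mem_nhds hz] with w hw
    exact dX_metricSymbol hU hG hdet hw μ
  rw [subprincipal, (symbolTerm_kleinGordon m (hS _ hz)).2.1]
  simp only [matDXi_congr (hdX _), matDXi_ofReal_smul_one (hdq _), Complex.ofReal_sum,
    Finset.sum_smul]

theorem dencker_kleinGordon (hU : IsOpen U) (hG : ∀ α β, ContDiffOn ℝ ∞ (fun y => G y α β) U)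
    (hdet : ∀ y ∈ U, (G y).det ≠ 0) (hsymm : ∀ y α β, G y α β = G y β α)
    (he : ∀ a μ, ContDiffOn ℝ ∞ (e a μ) U) (hz : z.1 ∈ U) (f : Phase N → Fin k → ℂ) :
    dencker (symbolTerm 2 (fullSymbol (kleinGordon G e ρ m)) 0)
        (symbolTerm 2 (fullSymbol (kleinGordon G e ρ m)) 1) (fun _ => 1) (metricSymbol G) f z =
      pullbackCov (twistedForm G e ρ) (hamVec (metricSymbol G)) f z := by
  -- By symmetry of `g⁻¹` the two spin terms of `p_1` agree; this accounts for the `2` in `∂q/∂ξ_μ =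
  -- -2 g^{μν} ξ_ν`.
  have hS : ∑ μ, dXi μ (metricSymbol G) z • spinForm G e ρ μ z.1
      = -∑ μ, ∑ ν, (G z.1)⁻¹ μ ν • (z.2 μ • spinForm G e ρ ν z.1
        + z.2 ν • spinForm G e ρ μ z.1) := by
    have h1 : ∑ μ, ∑ ν, ((G z.1)⁻¹ μ ν * z.2 μ) • spinForm G e ρ ν z.1
        = ∑ μ, ∑ ν, ((G z.1)⁻¹ μ ν * z.2 ν) • spinForm G e ρ μ z.1 := by
      rw [Finset.sum_comm]
      exact Finset.sum_congr rfl fun μ _ => Finset.sum_congr rfl fun ν _ => by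
        rw [inv_apply_comm (hsymm z.1)]
    simp only [dXi_metricSymbol hU hG hdet hsymm hz, smul_add, smul_smul, Finset.sum_add_distrib,
      h1, mul_smul (-2 : ℝ), Finset.sum_smul, ← Finset.smul_sum]
    module
  -- The heart of the matter: the twisted connection form on `dπ(X_q)` equals `i p^s`.
  have hM : ∑ μ, dXi μ (metricSymbol G) z • twistedForm G e ρ μ z.1
      = Complex.I • (kleinGordonSymbolOne G e ρ z
        + (Complex.I / 2) • ((∑ μ, dXi μ (dX μ (metricSymbol G)) z : ℝ) : ℂ) •
          (1 : Matrix (Fin k) (Fin k) ℂ)) := by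
    have hD := sum_dXi_mul_halfDensityForm hU hG hdet hsymm hz
    have h2 : ∑ μ, ∑ ν, (G z.1)⁻¹ μ ν • (∑ l, christoffel G l μ ν z.1 * z.2 l) •
        (1 : Matrix (Fin k) (Fin k) ℂ)
        = (∑ μ, ∑ ν, (G z.1)⁻¹ μ ν * ∑ l, christoffel G l μ ν z.1 * z.2 l) • 1 := by
      rw [Finset.sum_smul]
      refine Finset.sum_congr rfl fun μ _ => ?_
      rw [Finset.sum_smul]
      exact Finset.sum_congr rfl fun ν _ => smul_smul _ _ _
    have hOne : kleinGordonSymbolOne G e ρ z = Complex.I •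
        (∑ μ, ∑ ν, (G z.1)⁻¹ μ ν • (z.2 μ • spinForm G e ρ ν z.1 + z.2 ν • spinForm G e ρ μ z.1)
          - (∑ μ, ∑ ν, (G z.1)⁻¹ μ ν * ∑ l, christoffel G l μ ν z.1 * z.2 l) •
            (1 : Matrix (Fin k) (Fin k) ℂ)) := by
      rw [← h2]
      simp only [kleinGordonSymbolOne, smul_sub, Finset.sum_sub_distrib]
    have hL : ∑ μ, dXi μ (metricSymbol G) z • twistedForm G e ρ μ z.1
        = ∑ μ, dXi μ (metricSymbol G) z • spinForm G e ρ μ z.1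
          + (∑ μ, dXi μ (metricSymbol G) z * halfDensityForm G μ z.1) • 1 := by
      simp only [twistedForm, smul_add, Finset.sum_add_distrib, smul_smul, Finset.sum_smul]
    rw [hL, hS, hD, hOne, smul_add, smul_smul, smul_smul, smul_smul, Complex.I_mul_I, neg_smul,
      one_smul, show Complex.I * (Complex.I / 2) *
        ((∑ μ, dXi μ (dX μ (metricSymbol G)) z : ℝ) : ℂ)
      = ((-(1 / 2) * ∑ μ, dXi μ (dX μ (metricSymbol G)) z : ℝ) : ℂ) by
        push_cast
        linear_combination (1 / 2) * (∑ μ, ((dXi μ (dX μ (metricSymbol G)) z : ℝ) : ℂ)) *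
          Complex.I_sq, Complex.coe_smul]
    module
  simp only [dencker, matBracket_one_left, Matrix.zero_mulVec, smul_zero, add_zero, Matrix.one_mul,
    subprincipal_kleinGordon ρ m hU hG hdet he hz, pullbackCov]
  rw [← Matrix.smul_mulVec, ← hM]
  simp only [Matrix.sum_mulVec, Matrix.smul_mulVec, hamVec]

end Dencker

/-! ### Nondegeneracy of the metric in a chart. -/

section Bridge

variable {N : ℕ} {M : Type*} [TopologicalSpace M] [ChartedSpace (Coord N) M]

/-- The matrix is the Gram matrix of the metric in the coordinate basis. Nondegeneracy does not
depend on the basis and is visible in an orthonormal one, where the diagonal entries are `±1`. -/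
theorem det_coordMatrix_ne_zero [IsManifold (𝓡 (N + 1)) ∞ M] (g : LorentzMetric N M)
    {φ : OpenPartialHomeomorph M (Coord N)}
    (hφ : φ ∈ IsManifold.maximalAtlas (𝓡 (N + 1)) ∞ M) {x : Coord N} (hx : x ∈ φ.target) :
    (g.coordMatrix φ x).det ≠ 0 := by
  have hmd : φ.MDifferentiable (𝓡 (N + 1)) (𝓡 (N + 1)) :=
    ⟨(contMDiffOn_of_mem_maximalAtlas hφ).mdifferentiableOn (by simp),
      (contMDiffOn_symm_of_mem_maximalAtlas hφ).mdifferentiableOn (by simp)⟩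
  let T : Coord N ≃ₗ[ℝ] TangentSpace (𝓡 (N + 1)) (φ.symm x) :=
    (hmd.symm.mfderiv (x := x) hx).toLinearEquiv
  let w : Module.Basis (Fin (N + 1)) ℝ (TangentSpace (𝓡 (N + 1)) (φ.symm x)) :=
    (EuclideanSpace.basisFun (Fin (N + 1)) ℝ).toBasis.map T
  let B : LinearMap.BilinForm ℝ (TangentSpace (𝓡 (N + 1)) (φ.symm x)) := g.val (φ.symm x)
  obtain ⟨b, hb⟩ := g.signature (φ.symm x)
  have hB : B.Nondegenerate := by
    refine (LinearMap.BilinForm.nondegenerate_iff_det_ne_zero b).2 ?_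
    have : LinearMap.BilinForm.toMatrix b B = Matrix.diagonal (etaSign N) := by
      ext a c
      rw [LinearMap.BilinForm.toMatrix_apply, Matrix.diagonal_apply]
      exact hb a c
    rw [this, Matrix.det_diagonal]
    refine Finset.prod_ne_zero_iff.2 fun a _ => ?_
    unfold etaSign
    split_ifs <;> norm_num
  have h := (LinearMap.BilinForm.nondegenerate_iff_det_ne_zero w).1 hB
  have hm : LinearMap.BilinForm.toMatrix w B = g.coordMatrix φ x := by
    ext μ ν
    rw [LinearMap.BilinForm.toMatrix_apply]
    simp only [w, Module.Basis.map_apply, OrthonormalBasis.coe_toBasis,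
      EuclideanSpace.basisFun_apply]
    rfl
  rwa [hm] at h

end Bridge

end SpinorKG

/-! ### The proposition in a chart and a spin frame. -/

theorem mainTheorem7 {N k : ℕ} [NeZero k] {M : Type*} [TopologicalSpace M]
    [ChartedSpace (Coord N) M] [IsManifold (𝓡 (N + 1)) ∞ M]
    (g : LorentzMetric N M) {ι : Type*} (𝔰 : SpinStructure g ι)
    (ρ : CliffordAlgebra (minkowskiForm N) →ₐ[ℝ] Matrix (Fin k) (Fin k) ℂ) (m : ℝ)
    (φ : OpenPartialHomeomorph M (Coord N))
    (hφ : φ ∈ IsManifold.maximalAtlas (𝓡 (N + 1)) ∞ M) (i : ι) :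
    let G := g.coordMatrix φ
    let e := 𝔰.coordFrame i φ
    let Ω : Set (Phase N) := {z | z.1 ∈ 𝔰.coordDom i φ}
    let σ : Phase N → Matrix (Fin k) (Fin k) ℂ := fullSymbol (kleinGordon G e ρ m)
    let p := symbolTerm 2 σ
    let q : Phase N → ℝ := metricSymbol G
    let D := dencker (p 0) (p 1) (fun _ => 1) q
    let Q := charSet Ω (p 0)
    (∀ z ∈ Ω, σ z = p 0 z + p 1 z + p 2 z) ∧
    (∀ z ∈ Ω, p 0 z = (q z : ℂ) • (1 : Matrix (Fin k) (Fin k) ℂ)) ∧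
    IsRealPrincipalFactor Ω (p 0) (fun _ => 1) q ∧
    Q = {z ∈ Ω | ∑ μ, ∑ ν, (G z.1)⁻¹ μ ν * z.2 μ * z.2 ν = 0} ∧
    ∀ W ⊆ Ω, IsOpen W →
      (∀ f₁ f₂ : Phase N → Fin k → ℂ, ContDiffOn ℝ ∞ f₁ W → ContDiffOn ℝ ∞ f₂ W →
        Set.EqOn f₁ f₂ (W ∩ Q) → Set.EqOn (D f₁) (D f₂) (W ∩ Q)) ∧
      (∀ (h : Phase N → ℂ) (f : Phase N → Fin k → ℂ), ContDiffOn ℝ ∞ h W → ContDiffOn ℝ ∞ f W →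
        ∀ z ∈ W ∩ Q, D (fun w => h w • f w) z = fderiv ℝ h z (hamVec q z) • f z + h z • D f z) ∧
      (∀ f : Phase N → Fin k → ℂ, ContDiffOn ℝ ∞ f W →
        ∀ z ∈ W ∩ Q, D f z = pullbackCov (twistedForm G e ρ) (hamVec q) f z) := by

  intro G e Ω σ p q D Q
  have hUo : IsOpen (𝔰.coordDom i φ) := φ.isOpen_inter_preimage_symm (𝔰.isOpen_dom i)
  have hG : ∀ α β, ContDiffOn ℝ ∞ (fun y => G y α β) (𝔰.coordDom i φ) := fun α β =>
    (g.smooth φ hφ α β).mono Set.inter_subset_left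
  have hdet : ∀ y ∈ 𝔰.coordDom i φ, (G y).det ≠ 0 := fun y hy =>
    det_coordMatrix_ne_zero g hφ hy.1
  have hsymm : ∀ y α β, G y α β = G y β α := fun y α β => g.symm _ _ _
  have he : ∀ a μ, ContDiffOn ℝ ∞ (e a μ) (𝔰.coordDom i φ) := fun a μ =>
    𝔰.smooth_frame i φ hφ a μ
  have hS : ∀ y ∈ 𝔰.coordDom i φ, ∀ ν v,
      DifferentiableAt ℝ (fun y => spinForm G e ρ ν y *ᵥ v) y := fun y hy ν v =>
    ((contDiffOn_spinForm_mulVec ρ hUo hG hdet he ν v).contDiffAt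
      (hUo.mem_nhds hy)).differentiableAt (by simp)
  have hp : ∀ z ∈ Ω, p 0 z = (q z : ℂ) • (1 : Matrix (Fin k) (Fin k) ℂ) := fun z hz =>
    (symbolTerm_kleinGordon m (hS _ hz)).1
  have hq : ContDiffOn ℝ ∞ q Ω := contDiffOn_metricSymbol hG hdet
  have hD : ∀ z ∈ Ω, ∀ f, D f z = pullbackCov (twistedForm G e ρ) (hamVec q) f z := fun z hz f =>
    dencker_kleinGordon ρ m hUo hG hdet hsymm he hz f
  -- Here `det p_0 = q^k`, and `k ≠ 0` makes its zero set that of `q`.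
  have hQ : ∀ z, z ∈ Q ↔ z ∈ Ω ∧ q z = 0 := fun z =>
    and_congr_right fun hz => by
      rw [hp z hz, Matrix.det_smul, Matrix.det_one, mul_one, Fintype.card_fin,
        pow_eq_zero_iff (NeZero.ne k), Complex.ofReal_eq_zero]
  refine ⟨fun z hz => ?_, hp, ⟨fun _ _ => contDiffOn_const, hq, fun z hz => ?_, fun z hz hξ =>
    exists_dXi_metricSymbol_ne_zero hUo hG hdet hsymm hz hξ⟩, ?_, fun W hW hWo => ⟨?_, ?_, ?_⟩⟩
  · obtain ⟨h0, h1, h2⟩ := symbolTerm_kleinGordon m (hS _ hz)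
    simp only [p, σ]
    rw [h0, h1, h2]
    exact fullSymbol_kleinGordon_eq m (hS _ hz)
  · rw [Matrix.one_mul, hp z hz]
  · ext z
    rw [hQ]
    simp only [q, metricSymbol, neg_eq_zero, Set.mem_ofPred_eq]
  · intro f₁ f₂ h₁ h₂ heq z hz
    have hzΩ := hW hz.1
    have hWn := hWo.mem_nhds hz.1
    have hle : (1 : WithTop ℕ∞) ≤ ∞ := by simp
    rw [hD z hzΩ, hD z hzΩ, pullbackCov, pullbackCov, heq hz,
      fderiv_hamVec_congr ((hq.mono hW |>.contDiffAt hWn).of_le hle)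
        ((h₁.contDiffAt hWn).of_le hle) ((h₂.contDiffAt hWn).of_le hle) (heq hz)]
    -- Since `q z = 0`, the level set of `q` through `z` is, near `z`, the characteristic set, where
    -- the two functions agree.
    filter_upwards [hWn] with w hw hqw
    exact heq ⟨hw, (hQ w).2 ⟨hW hw, hqw.trans ((hQ z).1 hz.2).2⟩⟩
  · intro h f hh hf z hz
    have hWn := hWo.mem_nhds hz.1
    rw [hD z (hW hz.1), hD z (hW hz.1)]
    exact pullbackCov_smul _ _ ((hh.contDiffAt hWn).differentiableAt (by simp))
      ((hf.contDiffAt hWn).differentiableAt (by simp))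
  · exact fun f _ z hz => hD z (hW hz.1) f
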